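/- Alphabets are finite. A (multi-valued partial) function is a map $f$ from $\Sigma^*$ to the subsets of $\Gamma^*$, for alphabets $\Sigma,\Gamma$; it is single-valued if $|f(x)|\le 1$ for every $x$. An npda is a one-way one-head nondeterministic pushdown automaton (finite sets of inner states, stack symbols and transitions) that reads $x\in\Sigma^*$ between two endmarkers, may make $\lambda$-moves, stops upon entering an accepting or a rejecting state, and has a write-only output tape on which each move writes at most one symbol. All npda's are required to satisfy the termination condition: on every input $x$, all computation paths reach an accepting or a rejecting state within $O(|x|)$ steps. It computes the function that maps $x$ to the set of all words produced on the output tape along accepting computation paths on $x$. An oracle npda has in addition a write-only query tape, on which each move writes at most one symbol, and three extra inner states $q_{query},q_{yes},q_{no}$: when it enters $q_{query}$, the word $s$ on the query tape is sent to the oracle $A$, the query tape becomes blank, and the next inner state is $q_{yes}$ if $s\in A$ and $q_{no}$ otherwise. For oracle npda's, the termination condition is required with an $O(|x|)$ bound that holds no matter what oracle is used. $\mathrm{CFL}$ is the family of context-free languages, and $\mathrm{CFLSV}$ is the class of all single-valued functions computed by npda's. For a language $A$, $\mathrm{CFL}_T^A$ is the family of languages recognized with oracle $A$ by oracle npda's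 without output tape ($x$ is accepted iff some computation path on $x$ reaches an accepting state), and $\mathrm{CFLSV}_T^A$ is the class of all single-valued functions computed with oracle $A$ by oracle npda's. For a family $\mathcal C$ of languages, $\mathrm{CFL}_T(\mathcal C)=\bigcup_{A\in\mathcal C}\mathrm{CFL}_T^A$ and $\mathrm{CFLSV}_T(\mathcal C)=\bigcup_{A\in\mathcal C}\mathrm{CFLSV}_T^A$. Define, for $k\ge 1$, $$\Sigma^{\mathrm{CFL}}_1=\mathrm{CFL},\qquad \Pi^{\mathrm{CFL}}_k=\{\overline{L}\mid L\in\Sigma^{\mathrm{CFL}}_k\},\qquad \Sigma^{\mathrm{CFL}}_{k+1}=\mathrm{CFL}_T(\Pi^{\mathrm{CFL}}_k),$$ $$\Sigma^{\mathrm{CFL}}_1\mathrm{SV}=\mathrm{CFLSV},\qquad \Sigma^{\mathrm{CFL}}_{k+1}\mathrm{SV}=\mathrm{CFLSV}_T(\Pi^{\mathrm{CFL}}_k).$$ Let $e\ge 2$ and $k\ge 1$. If $\Sigma^{\mathrm{CFL}}_k\mathrm{SV}=\Sigma^{\mathrm{CFL}}_{k+1}\mathrm{SV}$, then $\Sigma^{\mathrm{CFL}}_k=\Sigma^{\mathrm{CFL}}_{k+1}$.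 If $\Sigma^{\mathrm{CFL}}_k=\Sigma^{\mathrm{CFL}}_{k+1}$, then $\Sigma^{\mathrm{CFL}}_{k+1}\mathrm{SV}=\Sigma^{\mathrm{CFL}}_{k+e}\mathrm{SV}$. -/

import Mathlib

namespace CFLHierarchy

/-! ### Families of languages and of multi-valued partial functions

Alphabets are finite types.  A multi-valued partial function is a map from words to sets of words;
it is undefined where the value is the empty set. -/

/-- A family of languages, over all finite alphabets `α`. -/
abbrev LanguageFamily : Type 1 :=
  (α : Type) → [Finite α] → Set (Language α)

/-- A family of multi-valued partial functions from words over `α` to words over `γ`,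
for all finite alphabets `α` and `γ`. -/
abbrev FunctionFamily : Type 1 :=
  (α γ : Type) → [Finite α] → [Finite γ] → Set (List α → Set (List γ))

/-- A multi-valued partial function is single-valued if it has at most one value everywhere. -/
def SingleValued {α γ : Type} (f : List α → Set (List γ)) : Prop :=
  ∀ x, (f x).Subsingleton

/-- The family `co-C` of the complements (with respect to all words over the same alphabet) of
the languages in `C`. -/
def co (C : LanguageFamily) : LanguageFamily :=
  fun α _ => {L | Lᶜ ∈ C α}

/-! ### Input tapes and the termination condition -/

/-- A symbol on the input tape: an input symbol or one of the two endmarkers. -/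
inductive TapeSymbol (α : Type) : Type
  | left : TapeSymbol α
  | letter (a : α) : TapeSymbol α
  | right : TapeSymbol α

/-- The input tape for the word `x`: left endmarker, `x`, right endmarker. -/
def inputTape {α : Type} (x : List α) : List (TapeSymbol α) :=
  TapeSymbol.left :: (x.map TapeSymbol.letter ++ [TapeSymbol.right])

/-- `TerminatesWithin step c halting t`: every computation path from `c` makes at most `t` steps,
and a path which cannot be continued has reached a halting configuration. -/
def TerminatesWithin {C : Type} (step : C → C → Prop) (c : C) (halting : C → Prop) (t : ℕ) : Prop :=
  (∀ (m : ℕ) (path : ℕ → C), path 0 = c → (∀ i < m, step (path i) (path (i + 1))) → m ≤ t) ∧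
  (∀ d, Relation.ReflTransGen step c d → (∀ d', ¬ step d d') → halting d)

/-! ### Nondeterministic pushdown automata with a write-only output tape -/

/-- A one-way one-head nondeterministic pushdown automaton with input alphabet `α` and a write-only
output tape over the alphabet `γ`.

`(p, w, v) ∈ trans q s z` means: in the inner state `q`, with `z` on top of the stack, the machine
may scan the tape symbol `s` and move its input head one cell to the right (if `s = none`, it makes
a move that does not touch the input tape), enter the state `p`, replace `z` by the word `w` (whose
first symbol becomes the topmost one), and write `v` on the output tape (nothing if `v = none`). -/
structure NPDA (α γ : Type) : Type 1 where
  State : Type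
  Stack : Type
  finite_state : Finite State
  finite_stack : Finite Stack
  start : State
  bottom : Stack
  acc : Set State
  rej : Set State
  acc_disjoint_rej : Disjoint acc rej
  trans : State → Option (TapeSymbol α) → Stack → Set (State × List Stack × Option γ)
  finite_trans : ∀ q s z, (trans q s z).Finite

namespace NPDA

variable {α γ : Type}

/-- A configuration: inner state, the part of the input tape not yet scanned, the stack (topmost
symbol first), and the content of the output tape. -/
structure Config (M : NPDA α γ) : Type where
  state : M.State
  input : List (TapeSymbol α)
  stack : List M.Stack
  output : List γ

/-- The halting states are the accepting and the rejecting ones. -/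
def halt (M : NPDA α γ) : Set M.State := M.acc ∪ M.rej

/-- One step of a computation.  No step is made from a halting state. -/
inductive Step (M : NPDA α γ) : M.Config → M.Config → Prop
  | scan {q p : M.State} {s : TapeSymbol α} {i : List (TapeSymbol α)} {z : M.Stack}
      {w st : List M.Stack} {v : Option γ} {o : List γ} :
      q ∉ M.halt → (p, w, v) ∈ M.trans q (some s) z →
      Step M ⟨q, s :: i, z :: st, o⟩ ⟨p, i, w ++ st, o ++ v.toList⟩
  | lambda {q p : M.State} {i : List (TapeSymbol α)} {z : M.Stack}
      {w st : List M.Stack} {v : Option γ} {o : List γ} :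
      q ∉ M.halt → (p, w, v) ∈ M.trans q none z →
      Step M ⟨q, i, z :: st, o⟩ ⟨p, i, w ++ st, o ++ v.toList⟩

/-- The initial configuration on the input `x`. -/
def init (M : NPDA α γ) (x : List α) : M.Config :=
  ⟨M.start, inputTape x, [M.bottom], []⟩

/-- The termination condition: all computation paths reach halting states in linearly many steps. -/
def Terminates (M : NPDA α γ) : Prop :=
  ∃ a b : ℕ, ∀ x : List α,
    TerminatesWithin M.Step (M.init x) (fun c => c.state ∈ M.halt) (a * x.length + b)

/-- The set of valid outcomes on the input `x`: the words produced along accepting paths. -/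
def outcomes (M : NPDA α γ) (x : List α) : Set (List γ) :=
  {y | ∃ c, Relation.ReflTransGen M.Step (M.init x) c ∧ c.state ∈ M.acc ∧ c.output = y}

end NPDA

/-! ### Oracle machines -/

/-- An oracle npda: a nondeterministic pushdown automaton with input alphabet `α`, a write-only query
tape over the alphabet `β`, a write-only output tape over the alphabet `γ`, and three extra inner
states `query`, `yes`, `no`.

`(p, w, u, v) ∈ trans q s z` is read as for an `NPDA`; in addition `u` is written on the query tape
(nothing if `u = none`). -/
structure OracleNPDA (α β γ : Type) : Type 1 where
  State : Type
  Stack : Type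
  finite_state : Finite State
  finite_stack : Finite Stack
  start : State
  bottom : Stack
  acc : Set State
  rej : Set State
  acc_disjoint_rej : Disjoint acc rej
  query : State
  yes : State
  no : State
  query_ne_yes : query ≠ yes
  query_ne_no : query ≠ no
  yes_ne_no : yes ≠ no
  query_not_halting : query ∉ acc ∪ rej
  yes_not_halting : yes ∉ acc ∪ rej
  no_not_halting : no ∉ acc ∪ rej
  trans : State → Option (TapeSymbol α) → Stack →
    Set (State × List Stack × Option β × Option γ)
  finite_trans : ∀ q s z, (trans q s z).Finite

namespace OracleNPDA

variable {α β γ : Type}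

/-- A configuration: inner state, the part of the input tape not yet scanned, the stack (topmost
symbol first), the content of the query tape, and the content of the output tape. -/
structure Config (M : OracleNPDA α β γ) : Type where
  state : M.State
  input : List (TapeSymbol α)
  stack : List M.Stack
  queryTape : List β
  output : List γ

/-- The halting states are the accepting and the rejecting ones. -/
def halt (M : OracleNPDA α β γ) : Set M.State := M.acc ∪ M.rej

/-- One step of a computation relative to the oracle `A`.  No step is made from a halting state.
In the query state the word on the query tape is sent to `A`, which sets the inner state to `yes` or
`no`; the query tape becomes blank again. -/
inductive Step (M : OracleNPDA α β γ) (A : Language β) : M.Config → M.Config → Prop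
  | scan {q p : M.State} {s : TapeSymbol α} {i : List (TapeSymbol α)} {z : M.Stack}
      {w st : List M.Stack} {u : Option β} {v : Option γ} {t : List β} {o : List γ} :
      q ∉ M.halt → q ≠ M.query → (p, w, u, v) ∈ M.trans q (some s) z →
      Step M A ⟨q, s :: i, z :: st, t, o⟩ ⟨p, i, w ++ st, t ++ u.toList, o ++ v.toList⟩
  | lambda {q p : M.State} {i : List (TapeSymbol α)} {z : M.Stack}
      {w st : List M.Stack} {u : Option β} {v : Option γ} {t : List β} {o : List γ} :
      q ∉ M.halt → q ≠ M.query → (p, w, u, v) ∈ M.trans q none z →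
      Step M A ⟨q, i, z :: st, t, o⟩ ⟨p, i, w ++ st, t ++ u.toList, o ++ v.toList⟩
  | answerYes {i : List (TapeSymbol α)} {st : List M.Stack} {t : List β} {o : List γ} :
      t ∈ A → Step M A ⟨M.query, i, st, t, o⟩ ⟨M.yes, i, st, [], o⟩
  | answerNo {i : List (TapeSymbol α)} {st : List M.Stack} {t : List β} {o : List γ} :
      t ∉ A → Step M A ⟨M.query, i, st, t, o⟩ ⟨M.no, i, st, [], o⟩

/-- The initial configuration on the input `x`. -/
def init (M : OracleNPDA α β γ) (x : List α) : M.Config :=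
  ⟨M.start, inputTape x, [M.bottom], [], []⟩

/-- The termination condition: all computation paths reach halting states in linearly many steps,
no matter what oracle is used. -/
def Terminates (M : OracleNPDA α β γ) : Prop :=
  ∃ a b : ℕ, ∀ (A : Language β) (x : List α),
    TerminatesWithin (M.Step A) (M.init x) (fun c => c.state ∈ M.halt) (a * x.length + b)

/-- The set of valid outcomes on the input `x` relative to the oracle `A`: the words produced
along accepting paths. -/
def outcomes (M : OracleNPDA α β γ) (A : Language β) (x : List α) : Set (List γ) :=
  {y | ∃ c, Relation.ReflTransGen (M.Step A) (M.init x) c ∧ c.state ∈ M.acc ∧ c.output = y}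

/-- The language recognized relative to the oracle `A`: the inputs with an accepting path. -/
def accepts (M : OracleNPDA α β γ) (A : Language β) : Language α :=
  {x | ∃ c, Relation.ReflTransGen (M.Step A) (M.init x) c ∧ c.state ∈ M.acc}

end OracleNPDA

/-! ### The classes -/

/-- The family of context-free languages. -/
def CFL : LanguageFamily :=
  fun α _ => {L : Language α | L.IsContextFree}

/-- The languages recognized with oracle `A` by oracle npda's satisfying the termination
condition.  A recognizer has no output tape: its output alphabet is empty. -/
def CFLTuring {β : Type} (A : Language β) : LanguageFamily :=
  fun α _ => {L | ∃ M : OracleNPDA α β Empty, M.Terminates ∧ M.accepts A = L}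

/-- The union of the families `CFLTuring A` over all languages `A` in `C`. -/
def CFLTuringFamily (C : LanguageFamily) : LanguageFamily :=
  fun α _ => {L | ∃ (β : Type) (_ : Finite β) (A : Language β), A ∈ C β ∧ L ∈ CFLTuring A α}

/-- The functions computed by npda's with an output tape that satisfy the termination condition. -/
def CFLMV : FunctionFamily :=
  fun α γ _ _ => {f | ∃ M : NPDA α γ, M.Terminates ∧ ∀ x, f x = M.outcomes x}

/-- The single-valued functions in `CFLMV`. -/
def CFLSV : FunctionFamily :=
  fun α γ _ _ => {f | f ∈ CFLMV α γ ∧ SingleValued f}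

/-- The functions computed with oracle `A` by oracle npda's that satisfy the termination
condition. -/
def CFLMVTuring {β : Type} (A : Language β) : FunctionFamily :=
  fun α γ _ _ => {f | ∃ M : OracleNPDA α β γ, M.Terminates ∧ ∀ x, f x = M.outcomes A x}

/-- The single-valued functions in `CFLMVTuring A`. -/
def CFLSVTuring {β : Type} (A : Language β) : FunctionFamily :=
  fun α γ _ _ => {f | f ∈ CFLMVTuring A α γ ∧ SingleValued f}

/-- The union of the families `CFLSVTuring A` over all languages `A` in `C`. -/
def CFLSVTuringFamily (C : LanguageFamily) : FunctionFamily :=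
  fun α γ _ _ => {f | ∃ (β : Type) (_ : Finite β) (A : Language β),
    A ∈ C β ∧ f ∈ CFLSVTuring A α γ}

/-- The `k`-th `Σ`-level of the CFL hierarchy, for `k ≥ 1`: level `1` is `CFL`, and level `k + 1`
is obtained by Turing relativization to the `k`-th `Π`-level, i.e. to the complements of the
languages in the `k`-th `Σ`-level.  (There is no level `0`; that value is a placeholder.) -/
def SigmaCFL : ℕ → LanguageFamily
  | 0 => fun _ _ => ∅
  | 1 => CFL
  | k + 2 => CFLTuringFamily (co (SigmaCFL (k + 1)))

/-- The `k`-th `Π`-level of the CFL hierarchy, for `k ≥ 1`. -/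
def PiCFL (k : ℕ) : LanguageFamily := co (SigmaCFL k)

/-- The `k`-th `Σ`-level of the hierarchy of single-valued functions over `CFLSV`, for `k ≥ 1`.
(There is no level `0`; that value is a placeholder.) -/
def SigmaCFLSV : ℕ → FunctionFamily
  | 0 => fun _ _ _ _ => ∅
  | 1 => CFLSV
  | k + 2 => CFLSVTuringFamily (PiCFL (k + 1))

end CFLHierarchy

namespace CFLHierarchy

/-!
A language is the domain of a function with empty output alphabet, and such a function is
single-valued, so an equality of two levels of the function hierarchy restricts to the levels of
the language hierarchy above the first, where functions and languages are computed by the same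
machines.  On the first level languages are given by grammars instead: the domain of a function
computed by an npda is context-free by the triple construction, applied to a pushdown system from
which the endmarkers have been removed.  Every level is contained in the next one, because a machine
can copy its input to the query tape and negate the answer of the oracle `Lᶜ`.

Conversely, each level of either hierarchy above the first depends only on the preceding level of
the language hierarchy, so a collapse of the latter propagates upwards in both.
-/

section Grammar

variable {T N : Type*}

/-- The words obtained from a sentential form by replacing each nonterminal `n` by a word of
`φ n`. -/
def formLanguage (φ : N → Language T) (u : List (Symbol T N)) : Language T :=
  (u.map fun
    | .terminal a => {[a]}
    | .nonterminal n => φ n).prod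

theorem formLanguage_append (φ : N → Language T) (u v : List (Symbol T N)) :
    formLanguage φ (u ++ v) = formLanguage φ u * formLanguage φ v := by
  simp only [formLanguage, List.map_append, List.prod_append]

theorem formLanguage_nonterminal (φ : N → Language T) (n : N) :
    formLanguage φ [.nonterminal n] = φ n := by
  simp only [formLanguage, List.map_singleton, List.prod_singleton]

theorem mem_formLanguage_terminal_iff (φ : N → Language T) {x y : List T} :
    y ∈ formLanguage φ (x.map .terminal) ↔ y = x := by
  induction x generalizing y with
  | nil => rfl
  | cons a x ih =>
    change y ∈ ({[a]} : Language T) * formLanguage φ (x.map .terminal) ↔ _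
    rw [Language.mem_mul]
    constructor
    · rintro ⟨_, rfl, z, hz, rfl⟩
      rw [ih.1 hz, List.singleton_append]
    · rintro rfl
      exact ⟨[a], rfl, x, ih.2 rfl, rfl⟩

theorem formLanguage_le_of_derives {g : ContextFreeGrammar T} {φ : g.NT → Language T}
    (hφ : ∀ ρ ∈ g.rules, formLanguage φ ρ.output ≤ φ ρ.input) {u v : List (Symbol T g.NT)}
    (h : g.Derives u v) : formLanguage φ v ≤ formLanguage φ u := by
  induction h with
  | refl => exact le_rfl
  | tail _ hstep ih =>
    refine le_trans ?_ ih
    obtain ⟨ρ, hρ, hrewrites⟩ := hstep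
    obtain ⟨p, q, rfl, rfl⟩ := hrewrites.exists_parts
    simp only [formLanguage_append, formLanguage_nonterminal]
    gcongr
    exact hφ ρ hρ

theorem language_le_of_forall_rules {g : ContextFreeGrammar T} {φ : g.NT → Language T}
    (hφ : ∀ ρ ∈ g.rules, formLanguage φ ρ.output ≤ φ ρ.input) : g.language ≤ φ g.initial := by
  intro x hx
  rw [← formLanguage_nonterminal φ g.initial]
  exact formLanguage_le_of_derives hφ hx ((mem_formLanguage_terminal_iff φ).2 rfl)

end Grammar

/-- A pushdown system over the alphabet `α`: `move q z a p w` means that the system may go from the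
state `q` to the state `p`, replacing the topmost stack symbol `z` by the word `w` (whose first
symbol becomes the topmost one) and reading `a` (nothing if `a = none`).  It has neither endmarkers
nor accepting states. -/
structure PushdownSystem (Q Γ α : Type*) where
  move : Q → Γ → Option α → Q → List Γ → Prop
  exists_length_le : ∃ B, ∀ {q z a p w}, move q z a p w → w.length ≤ B

namespace PushdownSystem

section Pops

variable {Q Γ α : Type*} (P : PushdownSystem Q Γ α)

/-- `P.Pops q s x r`: the system `P` can go from the state `q` with the stack `s` to the state `r`
with the empty stack while reading exactly the word `x`. -/
inductive Pops : Q → List Γ → List α → Q → Prop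
  | nil (q : Q) : Pops q [] [] q
  | step {q p r : Q} {z : Γ} {a : Option α} {w s : List Γ} {x : List α} :
      P.move q z a p w → Pops p (w ++ s) x r → Pops q (z :: s) (a.toList ++ x) r

/-- The big-step form of `Pops`, in which the word pushed by a move is popped before the rest of the
stack is touched. -/
inductive BigPops : Q → List Γ → List α → Q → Prop
  | nil (q : Q) : BigPops q [] [] q
  | step {q p t r : Q} {z : Γ} {a : Option α} {w s : List Γ} {x y : List α} :
      P.move q z a p w → BigPops p w x t → BigPops t s y r →
      BigPops q (z :: s) (a.toList ++ (x ++ y)) r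

variable {P}

theorem Pops.append {q p r : Q} {s t : List Γ} {x y : List α} (h : P.Pops q s x p)
    (h' : P.Pops p t y r) : P.Pops q (s ++ t) (x ++ y) r := by
  induction h with
  | nil => exact h'
  | step hmove _ ih =>
    rw [List.append_assoc]
    exact .step hmove (List.append_assoc .. ▸ ih h')

theorem BigPops.exists_of_append {q r : Q} {s t : List Γ} {x : List α}
    (h : P.BigPops q (s ++ t) x r) :
    ∃ p y z, x = y ++ z ∧ P.BigPops q s y p ∧ P.BigPops p t z r := by
  induction s generalizing q x with
  | nil => exact ⟨q, [], x, rfl, .nil q, h⟩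
  | cons _ s ih =>
    cases h with
    | step hmove hw hst =>
      obtain ⟨p, y, z, rfl, hs, ht⟩ := ih hst
      exact ⟨p, _, z, by simp only [List.append_assoc], .step hmove hw hs, ht⟩

theorem bigPops_iff_pops {q r : Q} {s : List Γ} {x : List α} :
    P.BigPops q s x r ↔ P.Pops q s x r := by
  constructor <;> intro h
  · induction h with
    | nil q => exact .nil q
    | step hmove _ _ ihw ihs => exact .step hmove (ihw.append ihs)
  · induction h with
    | nil q => exact .nil q
    | step hmove _ ih =>
      obtain ⟨_, _, _, rfl, hw, hs⟩ := ih.exists_of_append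
      exact .step hmove hw hs

end Pops

section TripleConstruction

variable {Q Γ : Type} {α : Type*} (P : PushdownSystem Q Γ α)

/-- The intended meaning of the nonterminals `(q, s, r)` of the triple construction: the words which
`P` can read while going from `q` to `r` and popping `s`. -/
def tripleLanguage : Q × List Γ × Q → Language α :=
  fun (q, s, r) => {x | P.BigPops q s x r}

/-- The rules of the triple construction, one for each constructor of `BigPops`.  Only stacks of
length at most `B` are used, in order that there are finitely many rules. -/
inductive IsTripleRule (B : ℕ) : ContextFreeRule α (Q × List Γ × Q) → Prop
  | nil (q : Q) : IsTripleRule B ⟨(q, [], q), []⟩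
  | step {q p : Q} {z : Γ} {a : Option α} {w s : List Γ} (t r : Q) :
      P.move q z a p w → w.length ≤ B → s.length ≤ B →
      IsTripleRule B ⟨(q, z :: s, r),
        a.toList.map .terminal ++ ([.nonterminal (p, w, t)] ++ [.nonterminal (t, s, r)])⟩

theorem finite_isTripleRule [Finite Q] [Finite Γ] [Finite α] (B : ℕ) :
    {ρ | P.IsTripleRule B ρ}.Finite := by
  have : Finite {w : List Γ // w.length ≤ B} := (List.finite_length_le Γ B).to_subtype
  let stepRule : Q × Q × Q × Q × Γ × Option α × {w : List Γ // w.length ≤ B} ×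
      {s : List Γ // s.length ≤ B} → ContextFreeRule α (Q × List Γ × Q) :=
    fun (q, p, t, r, z, a, w, s) => ⟨(q, z :: s, r),
      a.toList.map .terminal ++ ([.nonterminal (p, w, t)] ++ [.nonterminal (t, s, r)])⟩
  refine ((Set.finite_range fun q : Q => ⟨(q, [], q), []⟩).union
    (Set.finite_range stepRule)).subset ?_
  rintro _ (q | @⟨q, p, z, a, w, s, t, r, _, hw, hs⟩)
  · exact .inl ⟨q, rfl⟩
  · exact .inr ⟨(q, p, t, r, z, a, ⟨w, hw⟩, ⟨s, hs⟩), rfl⟩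

theorem formLanguage_tripleLanguage_output_le {B : ℕ} {ρ : ContextFreeRule α (Q × List Γ × Q)}
    (hρ : P.IsTripleRule B ρ) :
    formLanguage P.tripleLanguage ρ.output ≤ P.tripleLanguage ρ.input := by
  intro x hx
  cases hρ with
  | nil q =>
    obtain rfl : x = [] := hx
    exact .nil q
  | step t r hmove _ _ =>
    rw [formLanguage_append, formLanguage_append, formLanguage_nonterminal,
      formLanguage_nonterminal] at hx
    obtain ⟨_, ha, _, ⟨_, hw, _, hs, rfl⟩, rfl⟩ := hx
    obtain rfl := (mem_formLanguage_terminal_iff _).1 ha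
    exact BigPops.step hmove hw hs

theorem isContextFree_pops [Finite Q] [Finite Γ] [Finite α] (q : Q) (s : List Γ) (r : Q) :
    Language.IsContextFree ({x | P.Pops q s x r} : Language α) := by
  obtain ⟨B₀, hB₀⟩ := P.exists_length_le
  let B := max B₀ s.length
  let g : ContextFreeGrammar α :=
    ⟨Q × List Γ × Q, (q, s, r), (P.finite_isTripleRule B).toFinset⟩
  have mem_rules {ρ : ContextFreeRule α (Q × List Γ × Q)} : ρ ∈ g.rules ↔ P.IsTripleRule B ρ :=
    Set.Finite.mem_toFinset _
  have produces {ρ : ContextFreeRule α (Q × List Γ × Q)} (hρ : P.IsTripleRule B ρ) :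
      g.Produces [.nonterminal ρ.input] ρ.output :=
    ⟨ρ, mem_rules.2 hρ, ContextFreeRule.Rewrites.input_output⟩
  have sound : g.language ≤ P.tripleLanguage (q, s, r) :=
    language_le_of_forall_rules fun _ hρ =>
      P.formLanguage_tripleLanguage_output_le (mem_rules.1 hρ)
  have complete {p t : Q} {w : List Γ} {x : List α} (h : P.BigPops p w x t) (hlen : w.length ≤ B) :
      g.Derives [.nonterminal (p, w, t)] (x.map .terminal) := by
    induction h with
    | nil q => exact (produces (.nil q)).single
    | @step _ _ t r _ _ _ _ _ _ hmove _ _ ihw ihs =>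
      have hw := (hB₀ hmove).trans (le_max_left B₀ s.length)
      have hs := (Nat.le_succ _).trans hlen
      refine (produces (.step t r hmove hw hs)).trans_derives ?_
      simp only [List.map_append]
      exact (((ihw hw).append_right _).trans ((ihs hs).append_left _)).append_left _
  refine ⟨g, Set.ext fun x => ⟨fun hx => bigPops_iff_pops.1 (sound hx), fun hx => ?_⟩⟩
  exact complete (bigPops_iff_pops.2 hx) (le_max_right _ _)

end TripleConstruction

end PushdownSystem

section Transducer

variable {Q Γ S σ α : Type*}

/-- `Transduces τ f t x f'`: the finite-state transducer with moves `τ` can go from the state `f` to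
the state `f'` while reading `t` and writing `x`.  Here `τ f s a f'` is a move which reads `s` and
writes `a` (nothing if `a = none`). -/
inductive Transduces (τ : S → σ → Option α → S → Prop) : S → List σ → List α → S → Prop
  | nil (f : S) : Transduces τ f [] [] f
  | cons {f g f' : S} {s : σ} {a : Option α} {t : List σ} {x : List α} :
      τ f s a g → Transduces τ g t x f' → Transduces τ f (s :: t) (a.toList ++ x) f'

namespace PushdownSystem

/-- The moves of `PushdownSystem.transduce`. -/
inductive TransduceMove (P : PushdownSystem Q Γ σ) (τ : S → σ → Option α → S → Prop) :
    Q × S → Γ → Option α → Q × S → List Γ → Prop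
  | read {q p : Q} {f g : S} {z : Γ} {s : σ} {a : Option α} {w : List Γ} :
      P.move q z (some s) p w → τ f s a g → TransduceMove P τ (q, f) z a (p, g) w
  | lambda {q p : Q} {z : Γ} {w : List Γ} (f : S) :
      P.move q z none p w → TransduceMove P τ (q, f) z none (p, f) w

/-- The pushdown system which reads the words written by a transducer on the words read by `P`. -/
def transduce (P : PushdownSystem Q Γ σ) (τ : S → σ → Option α → S → Prop) :
    PushdownSystem (Q × S) Γ α where
  move := P.TransduceMove τ
  exists_length_le := P.exists_length_le.imp fun _ hB _ _ _ _ _ h => by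
    cases h with
    | read h _ | lambda _ h => exact hB h

theorem pops_transduce_iff {P : PushdownSystem Q Γ σ} {τ : S → σ → Option α → S → Prop} {q r : Q}
    {f f' : S} {s : List Γ} {x : List α} :
    (P.transduce τ).Pops (q, f) s x (r, f') ↔ ∃ t, P.Pops q s t r ∧ Transduces τ f t x f' := by
  constructor
  · intro h
    generalize hqf : (q, f) = c, hrf : (r, f') = d at h
    induction h generalizing q f with
    | nil =>
      obtain ⟨rfl, rfl⟩ := Prod.mk.inj (hqf.trans hrf.symm)
      exact ⟨[], .nil q, .nil f⟩
    | step hmove _ ih =>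
      cases hmove with
      | read hP hτ =>
        cases hqf
        obtain ⟨t, ht, hx⟩ := ih rfl hrf
        exact ⟨_ :: t, .step hP ht, .cons hτ hx⟩
      | lambda f hP =>
        cases hqf
        obtain ⟨t, ht, hx⟩ := ih rfl hrf
        exact ⟨t, .step hP ht, hx⟩
  · rintro ⟨t, ht, hx⟩
    induction ht generalizing f x with
    | nil q =>
      cases hx
      exact .nil _
    | @step _ _ _ _ a _ _ _ hP _ ih =>
      cases a with
      | none => exact .step (TransduceMove.lambda f hP) (ih hx)
      | some s =>
        cases hx with
        | cons hτ hx => exact .step (TransduceMove.read hP hτ) (ih hx)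

end PushdownSystem

end Transducer

/-- The position of the input head with respect to the endmarkers. -/
inductive HeadPhase : Type
  | start
  | middle
  | finish

instance : Finite HeadPhase :=
  Set.finite_univ_iff.1 <| (Set.toFinite {.start, .middle, .finish}).subset <| by
    rintro (_ | _ | _) - <;> simp

instance {α : Type} [Finite α] : Finite (TapeSymbol α) :=
  Set.finite_univ_iff.1 <| ((Set.finite_range .letter).union (Set.toFinite {.left, .right})).subset
    <| by rintro (_ | a | _) - <;> simp

/-- The moves of the transducer which removes the endmarkers from an input tape. -/
inductive StripMarkers {α : Type} : HeadPhase → TapeSymbol α → Option α → HeadPhase → Prop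
  | left : StripMarkers .start .left none .middle
  | letter (a : α) : StripMarkers .middle (.letter a) (some a) .middle
  | right : StripMarkers .middle .right none .finish

theorem transduces_stripMarkers_middle_iff {α : Type} {t : List (TapeSymbol α)} {x : List α} :
    Transduces StripMarkers .middle t x .finish ↔ t = x.map .letter ++ [.right] := by
  constructor
  · intro h
    induction t generalizing x with
    | nil => cases h
    | cons s t ih =>
      cases h with
      | cons hmove h =>
        cases hmove with
        | letter a => exact congrArg _ (ih h)
        | right =>
          cases h with
          | nil => rfl
          | cons hmove _ => cases hmove
  · rintro rfl
    induction x with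
    | nil => exact .cons StripMarkers.right (.nil _)
    | cons a x ih => exact .cons (StripMarkers.letter a) ih

theorem transduces_stripMarkers_iff {α : Type} {t : List (TapeSymbol α)} {x : List α} :
    Transduces StripMarkers .start t x .finish ↔ t = inputTape x := by
  constructor
  · rintro (_ | ⟨⟨⟩, h⟩)
    exact congrArg _ (transduces_stripMarkers_middle_iff.1 h)
  · rintro rfl
    exact .cons StripMarkers.left (transduces_stripMarkers_middle_iff.2 rfl)

namespace NPDA

variable {α γ : Type} (M : NPDA α γ)

/-- The moves of a pushdown system which reads the tapes accepted by `M`.  The stack of `M` lies on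
an additional bottom symbol `none`, so that `M` may also accept with the empty stack.  The state
`none` is entered when `M` has accepted: the rest of the tape is skipped and the stack discarded. -/
inductive AcceptMove : Option M.State → Option M.Stack → Option (TapeSymbol α) → Option M.State →
    List (Option M.Stack) → Prop
  | simulate {q p : M.State} {z : M.Stack} {s : Option (TapeSymbol α)} {w : List M.Stack}
      {v : Option γ} : q ∉ M.halt → (p, w, v) ∈ M.trans q s z →
      AcceptMove (some q) (some z) s (some p) (w.map some)
  | accept {q : M.State} (z : Option M.Stack) : q ∈ M.acc → AcceptMove (some q) z none none [z]
  | skip (z : Option M.Stack) (s : TapeSymbol α) : AcceptMove none z (some s) none [z]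
  | discard (z : Option M.Stack) : AcceptMove none z none none []

theorem exists_length_le_of_mem_trans [Finite α] :
    ∃ B, ∀ {q s z p w v}, (p, w, v) ∈ M.trans q s z → w.length ≤ B := by
  have := M.finite_state
  have := M.finite_stack
  have htrans : (⋃ q, ⋃ s, ⋃ z, M.trans q s z).Finite :=
    Set.finite_iUnion fun q => Set.finite_iUnion fun s => Set.finite_iUnion fun z =>
      M.finite_trans q s z
  obtain ⟨B, hB⟩ := (htrans.image fun m => m.2.1.length).bddAbove
  refine ⟨B, fun {q s z p w v} h => hB ⟨(p, w, v), ?_, rfl⟩⟩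
  simp only [Set.mem_iUnion]
  exact ⟨q, s, z, h⟩

/-- The pushdown system which reads the tapes accepted by `M`. -/
def acceptSystem [Finite α] :
    PushdownSystem (Option M.State) (Option M.Stack) (TapeSymbol α) where
  move := M.AcceptMove
  exists_length_le := by
    obtain ⟨B, hB⟩ := M.exists_length_le_of_mem_trans
    refine ⟨max B 1, fun h => ?_⟩
    cases h with
    | simulate _ h => exact (List.length_map _).trans_le ((hB h).trans (le_max_left _ _))
    | accept | skip => exact le_max_right _ _
    | discard => exact Nat.zero_le _

variable {M}

theorem Step.of_mem_trans {q p : M.State} {s : Option (TapeSymbol α)} {z : M.Stack}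
    {w : List M.Stack} {v : Option γ} (hq : q ∉ M.halt) (h : (p, w, v) ∈ M.trans q s z)
    (i : List (TapeSymbol α)) (st : List M.Stack) (o : List γ) :
    M.Step ⟨q, s.toList ++ i, z :: st, o⟩ ⟨p, i, w ++ st, o ++ v.toList⟩ := by
  cases s with
  | none => exact .lambda hq h
  | some s => exact .scan hq h

theorem pops_acceptSystem_none [Finite α] (z : Option M.Stack) (s : List (Option M.Stack))
    (i : List (TapeSymbol α)) : M.acceptSystem.Pops none (z :: s) i none := by
  induction i with
  | nil =>
    induction s generalizing z with
    | nil => exact .step (P := M.acceptSystem) (AcceptMove.discard z) (.nil _)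
    | cons y s ih => exact .step (P := M.acceptSystem) (AcceptMove.discard z) (ih y)
  | cons a i ih => exact .step (P := M.acceptSystem) (AcceptMove.skip z a) ih

theorem pops_acceptSystem_of_reflTransGen [Finite α] {c d : M.Config}
    (h : Relation.ReflTransGen M.Step c d) (hd : d.state ∈ M.acc) :
    M.acceptSystem.Pops (some c.state) (c.stack.map some ++ [none]) c.input none := by
  induction h using Relation.ReflTransGen.head_induction_on with
  | refl =>
    obtain ⟨z, s, hzs⟩ : ∃ z s, d.stack.map some ++ [none] = z :: s :=
      List.exists_cons_of_ne_nil (by simp)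
    rw [hzs]
    exact .step (P := M.acceptSystem) (AcceptMove.accept z hd) (pops_acceptSystem_none z s _)
  | head hstep _ ih =>
    cases hstep with
    | scan hq htrans | lambda hq htrans =>
      simp only [List.map_append, List.append_assoc] at ih
      exact .step (AcceptMove.simulate hq htrans) ih

theorem exists_reflTransGen_of_pops_acceptSystem [Finite α] {q : M.State} {st : List M.Stack}
    {i : List (TapeSymbol α)}
    (h : M.acceptSystem.Pops (some q) (st.map some ++ [none]) i none) (o : List γ) :
    ∃ c, Relation.ReflTransGen M.Step ⟨q, i, st, o⟩ c ∧ c.state ∈ M.acc := by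
  generalize hq : some q = q', hs : st.map some ++ [none] = s,
    hr : (none : Option M.State) = r at h
  induction h generalizing q st o with
  | nil => cases hq.trans hr.symm
  | step hmove _ ih =>
    cases hmove with
    | @simulate _ _ _ _ w v hhalt htrans =>
      cases hq
      cases st with
      | nil => cases hs
      | cons z st =>
        obtain ⟨⟨⟩, rfl⟩ := List.cons.inj hs
        obtain ⟨c, hc, hacc⟩ := ih (st := w ++ st) (o ++ v.toList) rfl (by simp) hr
        exact ⟨c, .head (.of_mem_trans hhalt htrans _ _ o) hc, hacc⟩
    | accept _ hacc =>
      cases hq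
      exact ⟨_, .refl, hacc⟩
    | skip | discard => cases hq

end NPDA

/-- The words on which a multi-valued partial function is defined. -/
def domain {α γ : Type} (f : List α → Set (List γ)) : Language α :=
  {x | (f x).Nonempty}

theorem isContextFree_domain_outcomes {α γ : Type} [Finite α] (M : NPDA α γ) :
    (domain M.outcomes).IsContextFree := by
  have := M.finite_state
  have := M.finite_stack
  have hdomain : domain M.outcomes = {x | (M.acceptSystem.transduce StripMarkers).Pops
      (some M.start, .start) [some M.bottom, none] x (none, .finish)} := by
    ext x
    change (M.outcomes x).Nonempty ↔ (M.acceptSystem.transduce StripMarkers).Pops _ _ x _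
    simp only [PushdownSystem.pops_transduce_iff, transduces_stripMarkers_iff, exists_eq_right]
    constructor
    · rintro ⟨_, c, hc, hacc, _⟩
      exact NPDA.pops_acceptSystem_of_reflTransGen hc hacc
    · intro h
      obtain ⟨c, hc, hacc⟩ := NPDA.exists_reflTransGen_of_pops_acceptSystem (st := [M.bottom]) h []
      exact ⟨_, c, hc, hacc, rfl⟩
  rw [hdomain]
  exact PushdownSystem.isContextFree_pops _ _ _ _

section Countdown

variable {C : Type} {step : C → C → Prop} {halting : C → Prop} {I : ℕ → C → Prop}

/-- `I` is an invariant with a ranking: `I n c` ensures that `c` is halting or has a successor, and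
each step from `c` leads to some `d` with `I m d` for some `m < n`. -/
structure IsCountdown (step : C → C → Prop) (halting : C → Prop) (I : ℕ → C → Prop) : Prop where
  exists_lt_of_step : ∀ {n c d}, I n c → step c d → ∃ m < n, I m d
  halting_or_exists_step : ∀ {n c}, I n c → halting c ∨ ∃ d, step c d

namespace IsCountdown

theorem exists_of_reflTransGen (hI : IsCountdown step halting I) {n : ℕ} {c d : C} (hc : I n c)
    (h : Relation.ReflTransGen step c d) : ∃ m, I m d := by
  induction h with
  | refl => exact ⟨n, hc⟩
  | tail _ hstep ih =>
    obtain ⟨m, hm⟩ := ih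
    obtain ⟨l, -, hl⟩ := hI.exists_lt_of_step hm hstep
    exact ⟨l, hl⟩

theorem terminatesWithin (hI : IsCountdown step halting I) {n : ℕ} {c : C} (hc : I n c) :
    TerminatesWithin step c halting n := by
  refine ⟨fun m path hpath hsteps => ?_, fun d hd hstuck => ?_⟩
  · have hrank : ∀ i ≤ m, ∃ l, l + i ≤ n ∧ I l (path i) := by
      intro i hi
      induction i with
      | zero => exact ⟨n, le_rfl, hpath ▸ hc⟩
      | succ i ih =>
        obtain ⟨l, hl, hIl⟩ := ih (Nat.le_of_succ_le hi)
        obtain ⟨l', hlt, hIl'⟩ := hI.exists_lt_of_step hIl (hsteps i hi)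
        exact ⟨l', by omega, hIl'⟩
    obtain ⟨l, hl, -⟩ := hrank m le_rfl
    exact (Nat.le_add_left m l).trans hl
  · obtain ⟨l, hl⟩ := hI.exists_of_reflTransGen hc hd
    exact (hI.halting_or_exists_step hl).resolve_right fun ⟨d', h⟩ => hstuck d' h

theorem exists_reflTransGen_halting (hI : IsCountdown step halting I) {n : ℕ} {c : C}
    (hc : I n c) : ∃ d, Relation.ReflTransGen step c d ∧ halting d := by
  induction n using Nat.strong_induction_on generalizing c with
  | _ n ih =>
    obtain hhalt | ⟨d, hstep⟩ := hI.halting_or_exists_step hc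
    · exact ⟨c, .refl, hhalt⟩
    · obtain ⟨m, hm, hd⟩ := hI.exists_lt_of_step hc hstep
      obtain ⟨e, hde, he⟩ := ih m hm hd
      exact ⟨e, .head hstep hde, he⟩

end IsCountdown

end Countdown

/-- The inner states of `complementMachine`.  The Boolean is the answer of the oracle. -/
inductive ComplementState : Type
  | copy
  | query
  | answer (b : Bool)
  | halt (b : Bool)

instance : Finite ComplementState :=
  Set.finite_univ_iff.1 <| ((Set.toFinite {.copy, .query}).union
    ((Set.finite_range .answer).union (Set.finite_range .halt))).subset <| by
      rintro (_ | _ | _ | _) - <;> simp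

/-- The oracle npda which copies its input to the query tape and accepts if the answer of the oracle
is negative. -/
def complementMachine (α : Type) : OracleNPDA α α Empty where
  State := ComplementState
  Stack := Unit
  finite_state := inferInstance
  finite_stack := inferInstance
  start := .copy
  bottom := ()
  acc := {.halt false}
  rej := {.halt true}
  acc_disjoint_rej := by simp
  query := .query
  yes := .answer true
  no := .answer false
  query_ne_yes := nofun
  query_ne_no := nofun
  yes_ne_no := by simp
  query_not_halting := by simp
  yes_not_halting := by simp
  no_not_halting := by simp
  trans q s z := match q, s with
    | .copy, some .left => {(.copy, [z], none, none)}
    | .copy, some (.letter a) => {(.copy, [z], some a, none)}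
    | .copy, some .right => {(.query, [z], none, none)}
    | .answer b, none => {(.halt b, [z], none, none)}
    | _, _ => ∅
  finite_trans q s z := by
    rcases q with _ | _ | _ | _ <;> rcases s with _ | _ | _ | _ <;> simp

namespace complementMachine

variable {α : Type} {A : Language α} {x : List α}

/-- `Run A x n c`: on the input `x` with the oracle `A`, the machine reaches the configuration `c`
and halts after `n` further steps. -/
inductive Run (A : Language α) (x : List α) : ℕ → (complementMachine α).Config → Prop
  | start : Run A x (x.length + 4) ⟨.copy, inputTape x, [()], [], []⟩
  | copy (u v : List α) : u ++ v = x →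
      Run A x (v.length + 3) ⟨.copy, v.map .letter ++ [.right], [()], u, []⟩
  | query : Run A x 2 ⟨.query, [], [()], x, []⟩
  | answer (b : Bool) : (b = true ↔ x ∈ A) → Run A x 1 ⟨.answer b, [], [()], [], []⟩
  | halt (b : Bool) : (b = true ↔ x ∈ A) → Run A x 0 ⟨.halt b, [], [()], [], []⟩

theorem Run.exists_lt_of_step {n : ℕ} {c d : (complementMachine α).Config} (hc : Run A x n c)
    (h : (complementMachine α).Step A c d) : ∃ m < n, Run A x m d := by
  cases hc with
  | start =>
    cases h with
    | scan _ _ htrans =>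
      cases htrans
      exact ⟨_, by omega, .copy [] x rfl⟩
    | lambda _ _ htrans => cases htrans
  | copy u v huv =>
    cases v with
    | nil =>
      obtain rfl : u = x := by simpa using huv
      cases h with
      | scan _ _ htrans =>
        cases htrans
        exact ⟨2, by simp, by simpa using .query⟩
      | lambda _ _ htrans => cases htrans
    | cons a v =>
      cases h with
      | scan _ _ htrans =>
        cases htrans
        exact ⟨_, by simp, .copy (u ++ [a]) v (by simpa using huv)⟩
      | lambda _ _ htrans => cases htrans
  | query =>
    cases h with
    | lambda _ hquery _ => exact absurd rfl hquery
    | answerYes hx => exact ⟨1, by omega, .answer true (iff_of_true rfl hx)⟩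
    | answerNo hx => exact ⟨1, by omega, .answer false (iff_of_false Bool.false_ne_true hx)⟩
  | answer b hb =>
    cases h with
    | lambda _ _ htrans =>
      cases htrans
      exact ⟨0, by omega, .halt b hb⟩
  | halt =>
    cases h with
    | lambda _ _ htrans => cases htrans

theorem Run.halting_or_exists_step {n : ℕ} {c : (complementMachine α).Config} (hc : Run A x n c) :
    c.state ∈ (complementMachine α).halt ∨ ∃ d, (complementMachine α).Step A c d := by
  have copy_notMem_halt : ComplementState.copy ∉ (complementMachine α).halt := by
    rintro (h | h) <;> cases h
  cases hc with
  | start => exact .inr ⟨_, .scan copy_notMem_halt nofun rfl⟩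
  | copy u v =>
    cases v with
    | nil => exact .inr ⟨_, .scan copy_notMem_halt nofun rfl⟩
    | cons a v => exact .inr ⟨_, .scan copy_notMem_halt nofun rfl⟩
  | query =>
    by_cases hx : x ∈ A
    · exact .inr ⟨_, .answerYes hx⟩
    · exact .inr ⟨_, .answerNo hx⟩
  | answer b => exact .inr ⟨_, .lambda (by rintro (h | h) <;> cases h) nofun rfl⟩
  | halt b =>
    cases b
    · exact .inl (.inl rfl)
    · exact .inl (.inr rfl)

theorem isCountdown_run (A : Language α) (x : List α) :
    IsCountdown ((complementMachine α).Step A) (fun c => c.state ∈ (complementMachine α).halt)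
      (Run A x) :=
  ⟨Run.exists_lt_of_step, Run.halting_or_exists_step⟩

theorem terminates (α : Type) : (complementMachine α).Terminates :=
  ⟨1, 4, fun A x => (one_mul x.length).symm ▸ (isCountdown_run A x).terminatesWithin .start⟩

theorem accepts_eq_compl (A : Language α) : (complementMachine α).accepts A = Aᶜ := by
  ext x
  have hrun := isCountdown_run A x
  constructor
  · rintro ⟨c, hc, hacc⟩
    obtain ⟨_, hc⟩ := hrun.exists_of_reflTransGen .start hc
    cases hc with
    | halt b hb =>
      cases hacc
      exact fun hx => Bool.false_ne_true (hb.2 hx)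
    | _ => cases hacc
  · intro hx
    obtain ⟨c, hc, hhalt⟩ := hrun.exists_reflTransGen_halting .start
    refine ⟨c, hc, hhalt.resolve_right fun hrej => hx ?_⟩
    obtain ⟨_, hc⟩ := hrun.exists_of_reflTransGen .start hc
    cases hc with
    | halt b hb =>
      cases hrej
      exact hb.1 rfl
    | _ => cases hrej

end complementMachine

theorem subset_cflTuringFamily_co (C : LanguageFamily) (α : Type) [Finite α] :
    C α ⊆ CFLTuringFamily (co C) α := fun L hL =>
  ⟨α, inferInstance, Lᶜ, by simpa [co] using hL,
    complementMachine α, complementMachine.terminates α, by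
      rw [complementMachine.accepts_eq_compl, compl_compl]⟩

theorem singleValued_of_isEmpty {α γ : Type} [IsEmpty γ] (f : List α → Set (List γ)) :
    SingleValued f :=
  fun _ => Set.subsingleton_of_subsingleton

theorem domain_outcomes {α β γ : Type} (M : OracleNPDA α β γ) (A : Language β) :
    domain (M.outcomes A) = M.accepts A :=
  Set.ext fun _ => ⟨fun ⟨_, c, hc, hacc, _⟩ => ⟨c, hc, hacc⟩,
    fun ⟨c, hc, hacc⟩ => ⟨_, c, hc, hacc, rfl⟩⟩

theorem mem_cflTuringFamily_iff_exists_domain_eq {C : LanguageFamily} {α : Type} [Finite α]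
    {L : Language α} :
    L ∈ CFLTuringFamily C α ↔ ∃ f ∈ CFLSVTuringFamily C α Empty, domain f = L := by
  constructor
  · rintro ⟨β, hβ, A, hA, M, hM, rfl⟩
    exact ⟨M.outcomes A, ⟨β, hβ, A, hA, ⟨M, hM, fun _ => rfl⟩, singleValued_of_isEmpty _⟩,
      domain_outcomes M A⟩
  · rintro ⟨f, ⟨β, hβ, A, hA, ⟨M, hM, hf⟩, _⟩, rfl⟩
    exact ⟨β, hβ, A, hA, M, hM, by rw [funext hf, domain_outcomes]⟩

theorem sigmaCFL_succ {k : ℕ} (hk : 1 ≤ k) : SigmaCFL (k + 1) = CFLTuringFamily (PiCFL k) :=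
  match k, hk with
  | _ + 1, _ => rfl

theorem sigmaCFLSV_succ {k : ℕ} (hk : 1 ≤ k) : SigmaCFLSV (k + 1) = CFLSVTuringFamily (PiCFL k) :=
  match k, hk with
  | _ + 1, _ => rfl

theorem sigmaCFL_subset_succ {k : ℕ} (hk : 1 ≤ k) (α : Type) [Finite α] :
    SigmaCFL k α ⊆ SigmaCFL (k + 1) α := by
  rw [sigmaCFL_succ hk]
  exact subset_cflTuringFamily_co _ α

theorem domain_mem_sigmaCFL {k : ℕ} {α : Type} [Finite α] {f : List α → Set (List Empty)}
    (hf : f ∈ SigmaCFLSV k α Empty) : domain f ∈ SigmaCFL k α := by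
  match k, hf with
  | 1, ⟨⟨M, _, hM⟩, _⟩ =>
    rw [funext hM]
    exact isContextFree_domain_outcomes M
  | _ + 2, hf => exact mem_cflTuringFamily_iff_exists_domain_eq.2 ⟨f, hf, rfl⟩

theorem sigmaCFL_eq_succ_of_sigmaCFLSV_eq_succ {k : ℕ} (hk : 1 ≤ k)
    (h : SigmaCFLSV k = SigmaCFLSV (k + 1)) : SigmaCFL k = SigmaCFL (k + 1) := by
  funext α _
  refine (sigmaCFL_subset_succ hk α).antisymm fun L hL => ?_
  rw [sigmaCFL_succ hk] at hL
  obtain ⟨f, hf, rfl⟩ := mem_cflTuringFamily_iff_exists_domain_eq.1 hL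
  rw [← sigmaCFLSV_succ hk, ← h] at hf
  exact domain_mem_sigmaCFL hf

theorem sigmaCFL_eq_of_le {k j : ℕ} (hk : 1 ≤ k) (h : SigmaCFL k = SigmaCFL (k + 1))
    (hkj : k ≤ j) : SigmaCFL j = SigmaCFL k := by
  induction j, hkj using Nat.le_induction with
  | base => rfl
  | succ j hkj ih =>
    calc SigmaCFL (j + 1) = CFLTuringFamily (co (SigmaCFL j)) := sigmaCFL_succ (hk.trans hkj)
      _ = CFLTuringFamily (co (SigmaCFL k)) := by rw [ih]
      _ = SigmaCFL (k + 1) := (sigmaCFL_succ hk).symm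
      _ = SigmaCFL k := h.symm

theorem sigmaCFLSV_succ_eq_of_le {k j : ℕ} (hk : 1 ≤ k) (h : SigmaCFL k = SigmaCFL (k + 1))
    (hkj : k ≤ j) : SigmaCFLSV (k + 1) = SigmaCFLSV (j + 1) := by
  rw [sigmaCFLSV_succ hk, sigmaCFLSV_succ (hk.trans hkj), PiCFL, PiCFL, sigmaCFL_eq_of_le hk h hkj]

end CFLHierarchy

theorem mainTheorem12 (e k : ℕ) (he : 2 ≤ e) (hk : 1 ≤ k) :
    (CFLHierarchy.SigmaCFLSV k = CFLHierarchy.SigmaCFLSV (k + 1) →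
      CFLHierarchy.SigmaCFL k = CFLHierarchy.SigmaCFL (k + 1)) ∧
    (CFLHierarchy.SigmaCFL k = CFLHierarchy.SigmaCFL (k + 1) →
      CFLHierarchy.SigmaCFLSV (k + 1) = CFLHierarchy.SigmaCFLSV (k + e)) := by
  refine ⟨CFLHierarchy.sigmaCFL_eq_succ_of_sigmaCFLSV_eq_succ hk, fun h => ?_⟩
  obtain ⟨j, rfl⟩ := Nat.exists_eq_add_of_le' (one_le_two.trans he)
  exact CFLHierarchy.sigmaCFLSV_succ_eq_of_le hk h (Nat.le_add_right k j)
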